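/- Let $n\ge 1$ be an integer with $n\neq 2$, and let $D$ be a set of divisors $d$ of $n$ with $1\le d<n$. Let $\mathrm{ICG}_n(D)$ be the integral circulant graph with vertex set $\mathbb{Z}/n\mathbb{Z}$ in which $a$ and $b$ are adjacent if and only if $\gcd(a-b,n)\in D$, and assume that $\mathrm{ICG}_n(D)$ is connected. A finite graph with adjacency matrix $A$ has perfect state transfer (PST) if there are distinct vertices $a,b$ and a real number $t>0$ such that $\left|\exp(\mathrm{i}tA)_{ab}\right|=1$. For $i\ge 0$ let $D_i=\{d\in D : v_2(n/d)=i\}$, where $v_2$ is the $2$-adic valuation, let $\widetilde{D_3}=\bigcup_{i\ge 3}D_i=\{d\in D : 8\mid n/d\}$, and write $kX=\{kx : x\in X\}$. Put $D_1^*=D_1\setminus\{n/2\}$ and $D_2^*=D_2\setminus\{n/4\}$. Then the following are equivalent: 1. $\mathrm{ICG}_n(D)$ has PST; 2. $4\mid n$, $D_1^*=2D_2^*$, $D_0=4D_2^*$, and exactly one of $n/2\in D$ and $n/4\in D$ holds; 3. $4\mid n$ and $D=\widetilde{D_3}\cup D_2^*\cup 2D_2^*\cup 4D_2^*\cup\{n/2^a\}$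 for some $a\in\{1,2\}$. -/

import Mathlib

/-- The integral circulant graph `ICG_n(D)`: the circulant graph on `ℤ/nℤ` whose symbol is the set
of residues `k` with `gcd(k, n) ∈ D`. -/
def integralCirculant (n : ℕ) (D : Finset ℕ) : SimpleGraph (ZMod n) :=
  SimpleGraph.circulantGraph {k : ZMod n | Nat.gcd k.val n ∈ D}

/-- For `D` a set of proper divisors of `n`, vertices `a` and `b` are adjacent in
`ICG_n(D)` exactly when `gcd(a - b, n) ∈ D`. -/
theorem integralCirculant_adj {n : ℕ} [NeZero n] {D : Finset ℕ} (hD : D ⊆ n.properDivisors)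
    (a b : ZMod n) :
    (integralCirculant n D).Adj a b ↔ Nat.gcd (a - b).val n ∈ D := by
  have hsymm : ∀ k : ZMod n, Nat.gcd (-k).val n = Nat.gcd k.val n := by
    intro k
    rw [ZMod.neg_val]
    split_ifs with h
    · simp [h]
    · have hk : k.val ≤ n := (ZMod.val_lt k).le
      rw [Nat.gcd_comm, Nat.gcd_comm k.val]
      exact Nat.gcd_self_sub_right hk
  have hba : Nat.gcd (b - a).val n = Nat.gcd (a - b).val n := by
    rw [← neg_sub a b, hsymm]
  simp only [integralCirculant, SimpleGraph.circulantGraph, SimpleGraph.fromRel_adj,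
    Set.mem_ofPred_eq, hba, or_self, and_iff_right_iff_imp]
  rintro h rfl
  have := Nat.mem_properDivisors.1 (hD h)
  simp at this

open Classical in
/-- Perfect state transfer in a finite graph: with `F(t) = exp(i t A)`, `A` the adjacency matrix,
there are distinct vertices `a`, `b` and a positive real `t` such that `|F(t)_{ab}| = 1`. -/
def HasPST {V : Type*} [Fintype V] (G : SimpleGraph V) : Prop :=
  ∃ a b : V, a ≠ b ∧ ∃ t : ℝ, 0 < t ∧
    ‖(NormedSpace.exp ((Complex.I * (t : ℂ)) • G.adjMatrix ℂ) : Matrix V V ℂ) a b‖ = 1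

/-- `D_i = {d ∈ D : S₂(n/d) = i}`, where `S₂` is the 2-adic valuation. -/
def valClass (n : ℕ) (D : Finset ℕ) (i : ℕ) : Finset ℕ :=
  {d ∈ D | padicValNat 2 (n / d) = i}

/-- `D̃₃ = ⋃_{i ≥ 3} D_i`, the set of those `d ∈ D` for which `8` divides `n / d`. -/
def valClassGeThree (n : ℕ) (D : Finset ℕ) : Finset ℕ :=
  {d ∈ D | 8 ∣ n / d}

/-- `kD = {k d : d ∈ D}`. -/
def dilate (k : ℕ) (D : Finset ℕ) : Finset ℕ :=
  D.image (fun d => k * d)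

/-! Let `F` be the indicator of `D` and `G` its Möbius inverse, so that F(d) is the sum of G(g) over
g ∣ d. The additive characters diagonalise the adjacency matrix, and the eigenvalue at j is the
integer L(c) = ∑_{h ∣ c} h·G(n/h) with c = gcd(j, n). Transfer from a to b says that exp(itL(gcd(j,
n))) is a constant of modulus one times χ_j(b - a). The eigenvalues at j and -j agree, so χ_1(b - a)
= -1; hence n is even and the phases are u·(-1)^c (`hasPST_integralCirculant_iff_exp`). For integers
L this means L(c) - L(n) ≡ 2^m·[c odd] mod 2^(m+1) for some m (`exists_phase_iff_parityCongruence`).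

Write n = 2^e·P with P odd, e ≥ 1. Testing the congruence at c = h and c = 2h for h ∣ P, and
inverting the odd weights modulo 2^(m+1), gives congruences for divisor sums of `G` on its top two
2-adic layers (`ParityCongruence.dvd_differences`). Such sums telescope to differences of `F`. Since
`F` is 0-1 valued and m ≥ 1, the congruences sharpen: for e ≥ 2, the layers e-2, e-1, e of `D` have
the same odd parts Q ≠ P, and exactly one of n/2, n/4 lies in `D`. Conversely these conditions give
the congruence with m = 1. Both combinatorial descriptions are this structure read layer by layer.
For e = 1 every element of `D` is a multiple of P, so connectedness forces n = 2. -/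

theorem sum_divisors_two_pow_succ_mul {M : Type*} [AddCommMonoid M] (f : ℕ → M) (k : ℕ) {Q : ℕ}
    (hQ : Odd Q) :
    ∑ g ∈ (2 ^ (k + 1) * Q).divisors, f g =
      ∑ g ∈ (2 ^ k * Q).divisors, f g + ∑ q ∈ Q.divisors, f (2 ^ (k + 1) * q) := by
  have hdisj : Disjoint (2 ^ k * Q).divisors (Q.divisors.image (2 ^ (k + 1) * ·)) := by
    rw [Finset.disjoint_left]
    intro g hg hg'
    obtain ⟨q, -, rfl⟩ := Finset.mem_image.1 hg'
    have h2 : 2 ^ k * 2 ∣ 2 ^ k * Q :=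
      (Dvd.intro q (by rw [pow_succ])).trans (Nat.dvd_of_mem_divisors hg)
    exact hQ.not_two_dvd_nat (Nat.dvd_of_mul_dvd_mul_left (by positivity) h2)
  have hset : (2 ^ (k + 1) * Q).divisors =
      (2 ^ k * Q).divisors ∪ Q.divisors.image (2 ^ (k + 1) * ·) := by
    have hQ0 : Q ≠ 0 := by rintro rfl; simp at hQ
    ext g
    simp only [Finset.mem_union, Nat.mem_divisors, Finset.mem_image]
    constructor
    · rintro ⟨hg, -⟩
      obtain ⟨j, q, hq, rfl⟩ := Nat.exists_eq_two_pow_mul_odd (n := g) (by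
        rintro rfl; simp at hg; exact hQ0 hg)
      have hqQ : q ∣ Q := (Nat.Coprime.pow_right _
        (Nat.coprime_two_right.2 hq)).dvd_of_dvd_mul_left ((Dvd.intro_left _ rfl).trans hg)
      have hj : 2 ^ j ∣ 2 ^ (k + 1) := (Nat.Coprime.pow_left _
        (Nat.coprime_two_left.2 hQ)).dvd_of_dvd_mul_right ((Dvd.intro _ rfl).trans hg)
      have hj := (Nat.pow_dvd_pow_iff_le_right (by norm_num)).1 hj
      rcases hj.lt_or_eq with hj | rfl
      · exact Or.inl ⟨mul_dvd_mul (pow_dvd_pow 2 (by omega)) hqQ, by positivity⟩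
      · exact Or.inr ⟨q, ⟨hqQ, hQ0⟩, rfl⟩
    · rintro (⟨hg, -⟩ | ⟨q, ⟨hq, -⟩, rfl⟩)
      · exact ⟨hg.trans (mul_dvd_mul (pow_dvd_pow 2 (Nat.le_succ k)) dvd_rfl), by positivity⟩
      · exact ⟨mul_dvd_mul_left _ hq, by positivity⟩
  rw [hset, Finset.sum_union hdisj, Finset.sum_image]
  intro a _ b _ h
  exact Nat.eq_of_mul_eq_mul_left (by positivity) h

/-- The value at a divisor `c` of `n` of the Fourier transform of
`s ↦ ∑ g ∣ gcd s n, G g`. -/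
def dualDivisorSum (n : ℕ) (G : ℕ → ℤ) (c : ℕ) : ℤ :=
  ∑ h ∈ c.divisors, (h : ℤ) * G (n / h)

/-! ### Triangular systems of divisor sums -/

/-- The term c = 1 cancels H(P), induction kills the intermediate terms, and the remaining weight h
is odd, hence a unit modulo 2^N. -/
theorem dvd_of_weighted_sum_modEq {P : ℕ} (hP : Odd P) {N : ℕ} (H : ℕ → ℤ)
    (hL : ∀ h, h ∣ P → ((2 : ℤ) ^ N) ∣ ∑ c ∈ h.divisors, (c : ℤ) * H (P / c) - H P) :
    ∀ h, h ∣ P → h ≠ 1 → ((2 : ℤ) ^ N) ∣ H (P / h) := by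
  intro h
  induction h using Nat.strong_induction_on with
  | _ h ih =>
    intro hd h1
    have h0 : h ≠ 0 := by rintro rfl; simp at hd; simp [hd] at hP
    have hodd : Odd h := Odd.of_dvd_nat hP hd
    have := hL h hd
    rw [← Nat.cons_self_properDivisors h0, Finset.sum_cons] at this
    have hm : 1 ∈ h.properDivisors := by
      rw [Nat.one_mem_properDivisors_iff_one_lt]; omega
    rw [← Finset.add_sum_erase _ _ hm] at this
    have hs : ((2 : ℤ) ^ N) ∣ ∑ c ∈ h.properDivisors.erase 1, (c : ℤ) * H (P / c) := by
      refine Finset.dvd_sum fun c hc => ?_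
      obtain ⟨hc1, hc⟩ := Finset.mem_erase.1 hc
      obtain ⟨hcd, hcl⟩ := Nat.mem_properDivisors.1 hc
      exact Dvd.dvd.mul_left (ih c hcl (hcd.trans hd) hc1) _
    have h2 : ((2 : ℤ) ^ N) ∣ (h : ℤ) * H (P / h) := by
      have := dvd_sub this hs
      simp only [Nat.cast_one, one_mul, Nat.div_one] at this
      refine this.trans (dvd_of_eq ?_)
      ring
    refine IsCoprime.dvd_of_dvd_mul_left (IsCoprime.pow_left ?_) h2
    exact_mod_cast Nat.isCoprime_iff_coprime.2 (Nat.coprime_two_left.2 hodd)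

theorem dvd_sum_divisors_of_weighted {P : ℕ} (hP : Odd P) {N : ℕ} (H : ℕ → ℤ)
    (hL : ∀ h, h ∣ P → ((2 : ℤ) ^ N) ∣ ∑ c ∈ h.divisors, (c : ℤ) * H (P / c) - H P) :
    (∀ Q, Q ∣ P → Q ≠ P → ((2 : ℤ) ^ N) ∣ ∑ q ∈ Q.divisors, H q) ∧
      ((2 : ℤ) ^ N) ∣ ∑ q ∈ P.divisors, H q - H P := by
  have hP0 : P ≠ 0 := by rintro rfl; simp at hP
  have key : ∀ q, q ∣ P → q ≠ P → ((2 : ℤ) ^ N) ∣ H q := by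
    rintro q ⟨r, rfl⟩ hne
    have hq : 0 < q := Nat.pos_of_ne_zero (by rintro rfl; simp at hP0)
    have := dvd_of_weighted_sum_modEq hP H hL r (Dvd.intro_left _ rfl)
      (by rintro rfl; simp at hne)
    rwa [Nat.mul_div_cancel _ (Nat.pos_of_ne_zero (by rintro rfl; simp at hP0))] at this
  constructor
  · intro Q hQ hne
    refine Finset.dvd_sum fun q hq => ?_
    have hq := Nat.dvd_of_mem_divisors hq
    refine key q (hq.trans hQ) ?_
    rintro rfl
    exact hne (Nat.dvd_antisymm hQ hq)
  · rw [← Nat.cons_self_properDivisors hP0, Finset.sum_cons, add_sub_cancel_left]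
    refine Finset.dvd_sum fun q hq => ?_
    obtain ⟨hq, hl⟩ := Nat.mem_properDivisors.1 hq
    exact key q hq hl.ne

/-- Exact, unweighted analogue of the triangular argument, used for the converse direction. -/
theorem eq_zero_of_sum_divisors_eq_zero {P : ℕ} (hP : P ≠ 0) (H : ℕ → ℤ)
    (h : ∀ Q, Q ∣ P → Q ≠ P → ∑ q ∈ Q.divisors, H q = 0) :
    ∀ q, q ∣ P → q ≠ P → H q = 0 := by
  intro q
  induction q using Nat.strong_induction_on with
  | _ q ih =>
    intro hd hne
    have h0 : q ≠ 0 := by rintro rfl; simp at hd; exact hP hd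
    have := h q hd hne
    rw [← Nat.cons_self_properDivisors h0, Finset.sum_cons, Finset.sum_eq_zero, add_zero] at this
    · exact this
    · intro c hc
      obtain ⟨hcd, hcl⟩ := Nat.mem_properDivisors.1 hc
      refine ih c hcl (hcd.trans hd) ?_
      have := Nat.le_of_dvd (Nat.pos_of_ne_zero hP) hd
      omega

/-! ### From eigenvalue congruences to the divisor set and back -/

theorem dualDivisorSum_odd {k P c : ℕ} (G : ℕ → ℤ) (hc : c ∣ P) :
    dualDivisorSum (2 ^ k * P) G c = ∑ h ∈ c.divisors, (h : ℤ) * G (2 ^ k * (P / h)) := by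
  refine Finset.sum_congr rfl fun h hh => ?_
  rw [Nat.mul_div_assoc _ ((Nat.dvd_of_mem_divisors hh).trans hc)]

/-- The new divisors of 2c are the 2h with h ∣ c, and their cofactors n/(2h) lie one 2-adic layer
lower; so doubling c isolates layer k of `G`. -/
theorem dualDivisorSum_two_mul {k P c : ℕ} (hP : Odd P) (G : ℕ → ℤ) (hc : c ∣ P) :
    dualDivisorSum (2 ^ (k + 1) * P) G (2 * c) = dualDivisorSum (2 ^ (k + 1) * P) G c +
      ∑ h ∈ c.divisors, (h : ℤ) * (2 * G (2 ^ k * (P / h))) := by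
  have := sum_divisors_two_pow_succ_mul (fun h => (h : ℤ) * G (2 ^ (k + 1) * P / h)) 0
    (Odd.of_dvd_nat hP hc)
  simp only [zero_add, pow_one, pow_zero, one_mul] at this
  rw [dualDivisorSum, this, dualDivisorSum]
  congr 1
  refine Finset.sum_congr rfl fun h hh => ?_
  have hd := (Nat.dvd_of_mem_divisors hh).trans hc
  have : 2 ^ (k + 1) * P / (2 * h) = 2 ^ k * (P / h) := by
    rw [← Nat.mul_div_assoc _ hd, pow_succ, mul_comm (2 ^ k) 2, mul_assoc,
      Nat.mul_div_mul_left _ _ two_pos]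
  rw [this]; push_cast; ring

/-- The congruences satisfied by the eigenvalues of a graph with perfect state transfer. -/
def ParityCongruence (n : ℕ) (L : ℕ → ℤ) : Prop :=
  ∃ m : ℕ, ∀ c, c ∣ n → (2 : ℤ) ^ (m + 1) ∣ L c - L n - (if Odd c then 2 ^ m else 0)

/-- Comparing c = h with c = 1 controls the top layer of `G`; comparing c = 2h with c = h controls
the layer below and retains the offset 2^m. -/
theorem ParityCongruence.dvd_differences {k P : ℕ} (hP : Odd P) {F G : ℕ → ℤ}
    (hFG : ∀ d, d ∣ 2 ^ (k + 1) * P → F d = ∑ g ∈ d.divisors, G g)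
    (h : ParityCongruence (2 ^ (k + 1) * P) (dualDivisorSum (2 ^ (k + 1) * P) G)) :
    ∃ m : ℕ, (∀ Q, Q ∣ P → Q ≠ P →
      (2 : ℤ) ^ (m + 1) ∣ F (2 ^ (k + 1) * Q) - F (2 ^ k * Q) ∧
      (2 : ℤ) ^ (m + 1) ∣ 2 * ∑ q ∈ Q.divisors, G (2 ^ k * q)) ∧
      (2 : ℤ) ^ (m + 1) ∣ 2 * (∑ q ∈ P.divisors, G (2 ^ k * q)) - 2 ^ m := by
  obtain ⟨m, hm⟩ := h
  set n := 2 ^ (k + 1) * P with hn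
  have h1 := dvd_sum_divisors_of_weighted hP (N := m + 1) (fun q => G (2 ^ (k + 1) * q)) (by
    intro h hh
    have a := hm h (hh.trans (Dvd.intro_left _ rfl))
    have b := hm 1 (one_dvd _)
    rw [if_pos (Odd.of_dvd_nat hP hh), dualDivisorSum_odd G hh] at a
    rw [if_pos odd_one, dualDivisorSum_odd G (one_dvd _)] at b
    refine (dvd_sub a b).trans (dvd_of_eq ?_)
    simp)
  have hodd2 : ∀ c, ¬ Odd (2 * c) := fun c => by simp
  have h2 : ∀ h, h ∣ P → (2 : ℤ) ^ (m + 1) ∣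
      ∑ c ∈ h.divisors, (c : ℤ) * (2 * G (2 ^ k * (P / c))) + 2 ^ m := by
    intro h hh
    have a := hm h (hh.trans (Dvd.intro_left _ rfl))
    have b := hm (2 * h) (by
      rw [hn, pow_succ']; exact mul_dvd_mul (Dvd.intro _ rfl) hh)
    rw [if_pos (Odd.of_dvd_nat hP hh)] at a
    rw [if_neg (hodd2 h), dualDivisorSum_two_mul hP G hh] at b
    refine (dvd_sub b a).trans (dvd_of_eq ?_)
    ring
  have h3 := dvd_sum_divisors_of_weighted hP (N := m + 1) (fun q => 2 * G (2 ^ k * q)) (by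
    intro h hh
    have b := h2 1 (one_dvd _)
    refine (dvd_sub (h2 h hh) b).trans (dvd_of_eq ?_)
    simp)
  refine ⟨m, fun Q hQ hne => ⟨?_, ?_⟩, ?_⟩
  · rw [hFG _ (mul_dvd_mul_left _ hQ), hFG _ (mul_dvd_mul (pow_dvd_pow 2 (Nat.le_succ k)) hQ),
      sum_divisors_two_pow_succ_mul G k (Odd.of_dvd_nat hP hQ), add_sub_cancel_left]
    exact h1.1 Q hQ hne
  · rw [Finset.mul_sum]
    exact h3.1 Q hQ hne
  · rw [Finset.mul_sum]
    have b := h2 1 (one_dvd _)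
    simp only [Nat.divisors_one, Finset.sum_singleton, Nat.cast_one, Nat.div_one, one_mul] at b
    -- Subtracting 2^(m+1) turns the offset +2^m into -2^m.
    have := dvd_sub (dvd_add h3.2 b) (Dvd.intro 1 rfl : (2 : ℤ) ^ (m + 1) ∣ 2 ^ (m + 1) * 1)
    refine this.trans (dvd_of_eq ?_)
    ring

theorem ParityCongruence.structure_of_four_dvd {k P : ℕ} (hP : Odd P) {F G : ℕ → ℤ}
    (hF : ∀ d, F d = 0 ∨ F d = 1)
    (hFG : ∀ d, d ∣ 2 ^ (k + 2) * P → F d = ∑ g ∈ d.divisors, G g)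
    (h : ParityCongruence (2 ^ (k + 2) * P) (dualDivisorSum (2 ^ (k + 2) * P) G)) :
    (∀ Q, Q ∣ P → Q ≠ P → F (2 ^ (k + 1) * Q) = F (2 ^ k * Q) ∧
      F (2 ^ (k + 2) * Q) = F (2 ^ k * Q)) ∧ F (2 ^ (k + 1) * P) ≠ F (2 ^ k * P) := by
  obtain ⟨m, h1, h2⟩ := h.dvd_differences hP hFG
  have hd : ∀ Q, Q ∣ P → ∑ q ∈ Q.divisors, G (2 ^ (k + 1) * q) =
      F (2 ^ (k + 1) * Q) - F (2 ^ k * Q) := by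
    intro Q hQ
    rw [hFG _ (mul_dvd_mul (pow_dvd_pow 2 (by omega)) hQ),
      hFG _ (mul_dvd_mul (pow_dvd_pow 2 (by omega)) hQ),
      sum_divisors_two_pow_succ_mul G k (Odd.of_dvd_nat hP hQ), add_sub_cancel_left]
  rw [hd P dvd_rfl] at h2
  -- With m = 0 an odd number 2x - 1 would be even. Hence the modulus is divisible by 4, enough to
  -- decide equality of 0-1 values even after doubling.
  have hm : m ≠ 0 := by
    rintro rfl
    norm_num at h2
    omega
  obtain ⟨l, rfl⟩ := Nat.exists_eq_succ_of_ne_zero hm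
  have h4 : (4 : ℤ) ∣ 2 ^ (l.succ + 1) := ⟨2 ^ l, by rw [Nat.succ_eq_add_one]; ring⟩
  constructor
  · intro Q hQ hne
    obtain ⟨a, b⟩ := h1 Q hQ hne
    rw [hd Q hQ] at b
    have a := h4.trans a
    have b := h4.trans b
    have := hF (2 ^ (k + 1) * Q)
    have := hF (2 ^ k * Q)
    have := hF (2 ^ (k + 2) * Q)
    have e : k + 1 + 1 = k + 2 := rfl
    rw [e] at a
    omega
  · intro he
    rw [he, sub_self, mul_zero, zero_sub, dvd_neg] at h2
    have := (pow_dvd_pow_iff (a := (2 : ℤ)) (by norm_num) (by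
      rw [Int.isUnit_iff]; norm_num)).1 h2
    omega

/-- Here the lower layer is layer 0, whose divisor sum is F(Q) itself and not a difference; so 4 ∣
2F(Q) gives vanishing. -/
theorem ParityCongruence.structure_of_two_mul_odd {P : ℕ} (hP : Odd P) {F G : ℕ → ℤ}
    (hF : ∀ d, F d = 0 ∨ F d = 1)
    (hFG : ∀ d, d ∣ 2 * P → F d = ∑ g ∈ d.divisors, G g)
    (h : ParityCongruence (2 * P) (dualDivisorSum (2 * P) G)) :
    ∀ Q, Q ∣ P → Q ≠ P → F Q = 0 ∧ F (2 * Q) = 0 := by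
  obtain ⟨m, h1, h2⟩ := ParityCongruence.dvd_differences (k := 0) hP (F := F) (G := G)
    (by simpa using hFG) (by simpa using h)
  simp only [zero_add, pow_one, pow_zero, one_mul] at h1 h2
  have hm : m ≠ 0 := by
    rintro rfl
    norm_num at h2
    omega
  obtain ⟨l, rfl⟩ := Nat.exists_eq_succ_of_ne_zero hm
  have h4 : (4 : ℤ) ∣ 2 ^ (l.succ + 1) := ⟨2 ^ l, by rw [Nat.succ_eq_add_one]; ring⟩
  intro Q hQ hne
  obtain ⟨a, b⟩ := h1 Q hQ hne
  rw [← hFG Q (hQ.trans (Dvd.intro_left _ rfl))] at b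
  have a := h4.trans a
  have b := h4.trans b
  have := hF Q
  have := hF (2 * Q)
  omega

/-- On divisors of P, the top two layers of `G` are supported at P. So L is constant on odd c, the
first doubling adds 2·G(n/2) = ±2, and later doublings add multiples of 4. -/
theorem parityCongruence_of_structure {k P : ℕ} (hP : Odd P) {F G : ℕ → ℤ}
    (hF : ∀ d, F d = 0 ∨ F d = 1)
    (hFG : ∀ d, d ∣ 2 ^ (k + 2) * P → F d = ∑ g ∈ d.divisors, G g)
    (h1 : ∀ Q, Q ∣ P → Q ≠ P → F (2 ^ (k + 1) * Q) = F (2 ^ k * Q) ∧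
      F (2 ^ (k + 2) * Q) = F (2 ^ k * Q)) (h2 : F (2 ^ (k + 1) * P) ≠ F (2 ^ k * P)) :
    ParityCongruence (2 ^ (k + 2) * P) (dualDivisorSum (2 ^ (k + 2) * P) G) := by
  have hP0 : P ≠ 0 := by rintro rfl; simp at hP
  have hd : ∀ i ≤ k + 1, ∀ Q, Q ∣ P → ∑ q ∈ Q.divisors, G (2 ^ (i + 1) * q) =
      F (2 ^ (i + 1) * Q) - F (2 ^ i * Q) := by
    intro i hi Q hQ
    rw [hFG _ (mul_dvd_mul (pow_dvd_pow 2 (by omega)) hQ),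
      hFG _ (mul_dvd_mul (pow_dvd_pow 2 (by omega)) hQ),
      sum_divisors_two_pow_succ_mul G i (Odd.of_dvd_nat hP hQ), add_sub_cancel_left]
  have g2 := eq_zero_of_sum_divisors_eq_zero hP0 (fun q => G (2 ^ (k + 2) * q)) (by
    intro Q hQ hne
    have := h1 Q hQ hne
    rw [hd (k + 1) le_rfl Q hQ, this.1, ← this.2, sub_self])
  have g1 := eq_zero_of_sum_divisors_eq_zero hP0 (fun q => G (2 ^ (k + 1) * q)) (by
    intro Q hQ hne
    have := h1 Q hQ hne
    rw [hd k (by omega) Q hQ, this.1, sub_self])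
  have gP : G (2 ^ (k + 1) * P) = F (2 ^ (k + 1) * P) - F (2 ^ k * P) := by
    rw [← hd k (by omega) P dvd_rfl, ← Nat.cons_self_properDivisors hP0, Finset.sum_cons,
      Finset.sum_eq_zero, add_zero]
    intro q hq
    obtain ⟨hq, hl⟩ := Nat.mem_properDivisors.1 hq
    exact g1 q hq hl.ne
  -- Only h = 1 survives, since P/h ≠ P otherwise.
  have single : ∀ c, c ∣ P → ∀ f : ℕ → ℤ, (∀ q, q ∣ P → q ≠ P → f q = 0) →
      ∑ h ∈ c.divisors, (h : ℤ) * f (P / h) = f P := by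
    intro c hc f hf
    have hc0 : c ≠ 0 := by rintro rfl; simp at hc; exact hP0 hc
    rw [Finset.sum_eq_single 1]
    · simp
    · intro b hb hb1
      have hbP := (Nat.dvd_of_mem_divisors hb).trans hc
      rw [hf _ (Nat.div_dvd_of_dvd hbP), mul_zero]
      intro he
      rcases (Nat.div_eq_self.1 he) with h | h
      · exact hP0 h
      · exact hb1 h
    · simp [hc0]
  have hodd : ∀ c, c ∣ P → dualDivisorSum (2 ^ (k + 2) * P) G c = G (2 ^ (k + 2) * P) := by
    intro c hc
    rw [dualDivisorSum_odd G hc]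
    exact single c hc (fun q => G (2 ^ (k + 2) * q)) g2
  have heven : ∀ j c, c ∣ P → (4 : ℤ) ∣ dualDivisorSum (2 ^ (k + 2) * P) G (2 ^ (j + 1) * c) -
      (G (2 ^ (k + 2) * P) + 2) := by
    intro j c hc
    induction j with
    | zero =>
      rw [zero_add, pow_one, dualDivisorSum_two_mul hP G hc, hodd c hc,
        single c hc (fun q => 2 * G (2 ^ (k + 1) * q)) (fun q hq hne => by
          rw [g1 q hq hne, mul_zero]), gP]
      have := hF (2 ^ (k + 1) * P)
      have := hF (2 ^ k * P)
      omega
    | succ j ih =>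
      have : dualDivisorSum (2 ^ (k + 2) * P) G (2 ^ (j + 1 + 1) * c) =
          dualDivisorSum (2 ^ (k + 2) * P) G (2 ^ (j + 1) * c) + _ :=
        sum_divisors_two_pow_succ_mul _ (j + 1) (Odd.of_dvd_nat hP hc)
      rw [this, add_sub_right_comm]
      refine dvd_add ih (Finset.dvd_sum fun q _ => ⟨2 ^ j * q * G (2 ^ (k + 2) * P /
        (2 ^ (j + 1 + 1) * q)), ?_⟩)
      push_cast
      ring
  -- The exponent m = 1: everything is compared modulo 4, with 2 separating odd from even c.
  refine ⟨1, fun c hc => ?_⟩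
  obtain ⟨j, c', hc', rfl⟩ := Nat.exists_eq_two_pow_mul_odd (n := c) (by
    rintro rfl; simp at hc; exact hP0 hc)
  have hcP : c' ∣ P := (Nat.Coprime.pow_right _ (Nat.coprime_two_right.2 hc')).dvd_of_dvd_mul_left
    ((Dvd.intro_left _ rfl).trans hc)
  have a := heven (k + 1) P dvd_rfl
  have e : k + 1 + 1 = k + 2 := rfl
  rw [e] at a
  cases j with
  | zero =>
    rw [pow_zero, one_mul, if_pos hc', hodd c' hcP]
    norm_num
    omega
  | succ j =>
    have b := heven j c' hcP
    have hne : ¬ Odd (2 ^ (j + 1) * c') := by simp [pow_succ', mul_assoc]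
    rw [if_neg hne]
    norm_num
    omega

/-! ### Valuation classes as 2-adic layers of divisors -/

theorem two_pow_mul_inj {i j Q R : ℕ} (hQ : Odd Q) (hR : Odd R) :
    2 ^ i * Q = 2 ^ j * R ↔ i = j ∧ Q = R := by
  constructor
  · intro h
    have hij : i = j := by
      rcases lt_trichotomy i j with hl | rfl | hl
      · obtain ⟨l, rfl⟩ := Nat.exists_eq_add_of_lt hl
        rw [add_assoc, pow_add, mul_assoc] at h
        have := Nat.eq_of_mul_eq_mul_left (by positivity) h
        exact absurd hQ (by rw [this, pow_succ', mul_assoc]; simp)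
      · rfl
      · obtain ⟨l, rfl⟩ := Nat.exists_eq_add_of_lt hl
        rw [add_assoc, pow_add, mul_assoc] at h
        have := Nat.eq_of_mul_eq_mul_left (by positivity) h
        exact absurd hR (by rw [← this, pow_succ', mul_assoc]; simp)
    subst hij
    exact ⟨rfl, Nat.eq_of_mul_eq_mul_left (by positivity) h⟩
  · rintro ⟨rfl, rfl⟩
    rfl

theorem exists_eq_two_pow_mul_of_dvd {e P d : ℕ} (hP : Odd P) (hd : d ∣ 2 ^ e * P) :
    ∃ i Q, i ≤ e ∧ Q ∣ P ∧ d = 2 ^ i * Q := by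
  have hP0 : P ≠ 0 := by rintro rfl; simp at hP
  obtain ⟨i, Q, hQ, rfl⟩ := Nat.exists_eq_two_pow_mul_odd (n := d) (by
    rintro rfl; simp at hd; exact hP0 hd)
  refine ⟨i, Q, ?_, (Nat.Coprime.pow_right _
    (Nat.coprime_two_right.2 hQ)).dvd_of_dvd_mul_left ((Dvd.intro_left _ rfl).trans hd), rfl⟩
  have hj : 2 ^ i ∣ 2 ^ e := (Nat.Coprime.pow_left _
    (Nat.coprime_two_left.2 hP)).dvd_of_dvd_mul_right ((Dvd.intro _ rfl).trans hd)
  exact (Nat.pow_dvd_pow_iff_le_right (by norm_num)).1 hj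

section Classes

variable {k P : ℕ} {D : Finset ℕ}

theorem two_pow_mul_div {e i Q : ℕ} (hi : i ≤ e) (hQ : Q ∣ P) :
    2 ^ e * P / (2 ^ i * Q) = 2 ^ (e - i) * (P / Q) := by
  rw [Nat.mul_div_mul_comm (pow_dvd_pow 2 hi) hQ, Nat.pow_div hi two_pos]

theorem odd_div_of_dvd {Q : ℕ} (hP : Odd P) (hQ : Q ∣ P) : Odd (P / Q) :=
  Odd.of_dvd_nat hP (Nat.div_dvd_of_dvd hQ)

/-- P/Q is odd, so the cofactor has valuation e - i; the additive form avoids truncated subtraction.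
-/
theorem mem_valClass_two_pow_mul {e i Q v : ℕ} (hP : Odd P) (hi : i ≤ e) (hQ : Q ∣ P) :
    2 ^ i * Q ∈ valClass (2 ^ e * P) D v ↔ 2 ^ i * Q ∈ D ∧ i + v = e := by
  have ho := odd_div_of_dvd hP hQ
  have h0 : P / Q ≠ 0 := by intro h; simp [h] at ho
  have hv : padicValNat 2 (P / Q) = 0 :=
    padicValNat.eq_zero_of_not_dvd ho.not_two_dvd_nat
  rw [valClass, Finset.mem_filter, two_pow_mul_div hi hQ,
    padicValNat.mul (by positivity) h0, padicValNat.prime_pow, hv]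
  have : e - i + 0 = v ↔ i + v = e := by omega
  rw [this]

theorem mem_valClassGeThree_two_pow_mul {e i Q : ℕ} (hP : Odd P) (hi : i ≤ e) (hQ : Q ∣ P) :
    2 ^ i * Q ∈ valClassGeThree (2 ^ e * P) D ↔ 2 ^ i * Q ∈ D ∧ i + 3 ≤ e := by
  have ho := odd_div_of_dvd hP hQ
  rw [valClassGeThree, Finset.mem_filter, two_pow_mul_div hi hQ]
  have : 8 ∣ 2 ^ (e - i) * (P / Q) ↔ i + 3 ≤ e := by
    rw [show 8 = 2 ^ 3 by norm_num, (Nat.Coprime.pow_left 3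
      (Nat.coprime_two_left.2 ho)).dvd_mul_right, Nat.pow_dvd_pow_iff_le_right (by norm_num)]
    omega
  rw [this]

/-- The structure of the divisor sets of integral circulant graphs with perfect state transfer,
on `n = 2 ^ (k + 2) * P` vertices with `P` odd. -/
def TransferStructure (k P : ℕ) (D : Finset ℕ) : Prop :=
  (∀ Q, Q ∣ P → Q ≠ P → (2 ^ (k + 1) * Q ∈ D ↔ 2 ^ k * Q ∈ D) ∧
    (2 ^ (k + 2) * Q ∈ D ↔ 2 ^ k * Q ∈ D)) ∧ ¬(2 ^ (k + 1) * P ∈ D ↔ 2 ^ k * P ∈ D)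

theorem two_pow_mul_div_four : 2 ^ (k + 2) * P / 4 = 2 ^ k * P := by
  rw [pow_add, mul_right_comm, show 2 ^ 2 = 4 by norm_num, Nat.mul_div_cancel _ (by norm_num)]

theorem two_pow_mul_div_two : 2 ^ (k + 2) * P / 2 = 2 ^ (k + 1) * P := by
  rw [pow_succ, mul_right_comm, Nat.mul_div_cancel _ (by norm_num)]

theorem mem_valClass_two_sdiff (hP : Odd P) (hD : D ⊆ (2 ^ (k + 2) * P).properDivisors) {x : ℕ} :
    x ∈ valClass (2 ^ (k + 2) * P) D 2 \ {2 ^ (k + 2) * P / 4} ↔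
      ∃ Q, Q ∣ P ∧ Q ≠ P ∧ x = 2 ^ k * Q ∧ x ∈ D := by
  rw [two_pow_mul_div_four, Finset.mem_sdiff, Finset.mem_singleton]
  constructor
  · rintro ⟨hx, hne⟩
    have hxD : x ∈ D := (Finset.mem_filter.1 hx).1
    obtain ⟨i, Q, hi, hQ, rfl⟩ :=
      exists_eq_two_pow_mul_of_dvd hP (Nat.mem_properDivisors.1 (hD hxD)).1
    obtain ⟨-, h⟩ := (mem_valClass_two_pow_mul hP hi hQ).1 hx
    obtain rfl : i = k := by omega
    exact ⟨Q, hQ, by rintro rfl; exact hne rfl, rfl, hxD⟩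
  · rintro ⟨Q, hQ, hne, rfl, hx⟩
    refine ⟨(mem_valClass_two_pow_mul hP (by omega) hQ).2 ⟨hx, rfl⟩, fun h => hne ?_⟩
    exact ((two_pow_mul_inj (Odd.of_dvd_nat hP hQ) hP).1 h).2

/-- Dilation by 2^s moves layer k to layer k + s and keeps the odd part; deleting n/4 is the
condition Q ≠ P. -/
theorem two_pow_mul_mem_dilate (hP : Odd P) (hD : D ⊆ (2 ^ (k + 2) * P).properDivisors)
    {i s Q : ℕ} (hQ : Q ∣ P) :
    2 ^ i * Q ∈ dilate (2 ^ s) (valClass (2 ^ (k + 2) * P) D 2 \ {2 ^ (k + 2) * P / 4}) ↔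
      i = k + s ∧ Q ≠ P ∧ 2 ^ k * Q ∈ D := by
  rw [dilate, Finset.mem_image]
  constructor
  · rintro ⟨x, hx, h⟩
    obtain ⟨R, hR, hne, rfl, hx⟩ := (mem_valClass_two_sdiff hP hD).1 hx
    rw [← mul_assoc, ← pow_add, two_pow_mul_inj (Odd.of_dvd_nat hP hR) (Odd.of_dvd_nat hP hQ)] at h
    obtain ⟨h, rfl⟩ := h
    exact ⟨by omega, hne, hx⟩
  · rintro ⟨rfl, hne, hx⟩
    exact ⟨_, (mem_valClass_two_sdiff hP hD).2 ⟨Q, hQ, hne, rfl, hx⟩, by ring⟩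

theorem dilate_subset_divisors (hP : Odd P) (hD : D ⊆ (2 ^ (k + 2) * P).properDivisors)
    {s : ℕ} (hs : s ≤ 2) :
    dilate (2 ^ s) (valClass (2 ^ (k + 2) * P) D 2 \ {2 ^ (k + 2) * P / 4}) ⊆
      (2 ^ (k + 2) * P).divisors := by
  have hP0 : P ≠ 0 := by rintro rfl; simp at hP
  intro x hx
  obtain ⟨y, hy, rfl⟩ := Finset.mem_image.1 hx
  obtain ⟨R, hR, -, rfl, -⟩ := (mem_valClass_two_sdiff hP hD).1 hy
  rw [← mul_assoc, ← pow_add, Nat.mem_divisors]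
  exact ⟨mul_dvd_mul (pow_dvd_pow 2 (by omega)) hR, by positivity⟩

theorem eq_iff_of_subset_divisors {e : ℕ} (hP : Odd P) {A B : Finset ℕ}
    (hA : A ⊆ (2 ^ e * P).divisors) (hB : B ⊆ (2 ^ e * P).divisors) :
    A = B ↔ ∀ i Q, i ≤ e → Q ∣ P → (2 ^ i * Q ∈ A ↔ 2 ^ i * Q ∈ B) := by
  constructor
  · rintro rfl
    simp
  · intro h
    ext x
    by_cases hx : x ∈ (2 ^ e * P).divisors
    · obtain ⟨i, Q, hi, hQ, rfl⟩ := exists_eq_two_pow_mul_of_dvd hP (Nat.dvd_of_mem_divisors hx)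
      exact h i Q hi hQ
    · exact iff_of_false (fun h => hx (hA h)) (fun h => hx (hB h))

theorem two_pow_mul_self_notMem (hD : D ⊆ (2 ^ (k + 2) * P).properDivisors) :
    2 ^ (k + 2) * P ∉ D := fun h => by
  have := (Nat.mem_properDivisors.1 (hD h)).2
  omega

theorem transferStructure_iff_valClass (hP : Odd P)
    (hD : D ⊆ (2 ^ (k + 2) * P).properDivisors) :
    TransferStructure k P D ↔
      valClass (2 ^ (k + 2) * P) D 1 \ {2 ^ (k + 2) * P / 2} =
          dilate 2 (valClass (2 ^ (k + 2) * P) D 2 \ {2 ^ (k + 2) * P / 4}) ∧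
        valClass (2 ^ (k + 2) * P) D 0 =
          dilate 4 (valClass (2 ^ (k + 2) * P) D 2 \ {2 ^ (k + 2) * P / 4}) ∧
        ((2 ^ (k + 2) * P / 2 ∈ D ∧ 2 ^ (k + 2) * P / 4 ∉ D) ∨
          (2 ^ (k + 2) * P / 4 ∈ D ∧ 2 ^ (k + 2) * P / 2 ∉ D)) := by
  have hself := two_pow_mul_self_notMem hD
  have hxor : ((2 ^ (k + 2) * P / 2 ∈ D ∧ 2 ^ (k + 2) * P / 4 ∉ D) ∨
      (2 ^ (k + 2) * P / 4 ∈ D ∧ 2 ^ (k + 2) * P / 2 ∉ D)) ↔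
      ¬(2 ^ (k + 1) * P ∈ D ↔ 2 ^ k * P ∈ D) := by
    rw [two_pow_mul_div_four, two_pow_mul_div_two]
    tauto
  have m1 : ∀ i Q, i ≤ k + 2 → Q ∣ P →
      (2 ^ i * Q ∈ valClass (2 ^ (k + 2) * P) D 1 \ {2 ^ (k + 2) * P / 2} ↔
        i = k + 1 ∧ Q ≠ P ∧ 2 ^ (k + 1) * Q ∈ D) := by
    intro i Q hi hQ
    rw [two_pow_mul_div_two, Finset.mem_sdiff, Finset.mem_singleton,
      mem_valClass_two_pow_mul hP hi hQ, two_pow_mul_inj (Odd.of_dvd_nat hP hQ) hP]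
    constructor
    · rintro ⟨⟨a, b⟩, c⟩
      obtain rfl : i = k + 1 := by omega
      exact ⟨rfl, fun h => c ⟨rfl, h⟩, a⟩
    · rintro ⟨rfl, b, c⟩
      exact ⟨⟨c, rfl⟩, fun h => b h.2⟩
  have m0 : ∀ i Q, i ≤ k + 2 → Q ∣ P →
      (2 ^ i * Q ∈ valClass (2 ^ (k + 2) * P) D 0 ↔
        i = k + 2 ∧ 2 ^ (k + 2) * Q ∈ D) := by
    intro i Q hi hQ
    rw [mem_valClass_two_pow_mul hP hi hQ]
    constructor
    · rintro ⟨a, b⟩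
      obtain rfl : i = k + 2 := by omega
      exact ⟨rfl, a⟩
    · rintro ⟨rfl, b⟩
      exact ⟨b, rfl⟩
  have hsub : D ⊆ (2 ^ (k + 2) * P).divisors := hD.trans Nat.properDivisors_subset_divisors
  have hv : ∀ v, valClass (2 ^ (k + 2) * P) D v ⊆ (2 ^ (k + 2) * P).divisors := fun v =>
    (Finset.filter_subset _ _).trans hsub
  have e1 := eq_iff_of_subset_divisors
    (A := valClass (2 ^ (k + 2) * P) D 1 \ {2 ^ (k + 2) * P / 2}) hP
    (Finset.sdiff_subset.trans (hv 1))
    (dilate_subset_divisors hP hD one_le_two)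
  have e0 := eq_iff_of_subset_divisors hP (hv 0) (dilate_subset_divisors hP hD le_rfl)
  rw [hxor, TransferStructure]
  refine Iff.trans ?_ (and_congr e1.symm (and_congr_left' e0.symm))
  rw [← and_assoc]
  refine and_congr_left' ?_
  constructor
  · intro h
    constructor
    · intro i Q hi hQ
      rw [m1 i Q hi hQ, two_pow_mul_mem_dilate hP hD hQ]
      exact and_congr_right fun _ => and_congr_right fun hne => (h Q hQ hne).1
    · intro i Q hi hQ
      rw [m0 i Q hi hQ, two_pow_mul_mem_dilate hP hD hQ]
      refine and_congr_right fun _ => ⟨fun hq => ?_, fun hq => (h Q hQ hq.1).2.2 hq.2⟩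
      -- No deletion is needed in class 0: its element with odd part P would be n, which is not a
      -- proper divisor.
      have hne : Q ≠ P := by rintro rfl; exact hself hq
      exact ⟨hne, (h Q hQ hne).2.1 hq⟩
  · rintro ⟨h1, h0⟩ Q hQ hne
    have h1 := h1 (k + 1) Q (by omega) hQ
    have h0 := h0 (k + 2) Q le_rfl hQ
    rw [m1 _ Q (by omega) hQ, two_pow_mul_mem_dilate hP hD hQ] at h1
    rw [m0 _ Q le_rfl hQ, two_pow_mul_mem_dilate hP hD hQ] at h0
    simp only [true_and, hne, ne_eq, not_false_eq_true] at h1 h0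
    exact ⟨h1, h0⟩

theorem transferStructure_iff_eq_union (hP : Odd P)
    (hD : D ⊆ (2 ^ (k + 2) * P).properDivisors) :
    TransferStructure k P D ↔
      ∃ a : ℕ, (a = 1 ∨ a = 2) ∧
        D = valClassGeThree (2 ^ (k + 2) * P) D ∪
          (valClass (2 ^ (k + 2) * P) D 2 \ {2 ^ (k + 2) * P / 4}) ∪
          dilate 2 (valClass (2 ^ (k + 2) * P) D 2 \ {2 ^ (k + 2) * P / 4}) ∪
          dilate 4 (valClass (2 ^ (k + 2) * P) D 2 \ {2 ^ (k + 2) * P / 4}) ∪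
          {2 ^ (k + 2) * P / 2 ^ a} := by
  have hself := two_pow_mul_self_notMem hD
  have hsub : D ⊆ (2 ^ (k + 2) * P).divisors := hD.trans Nat.properDivisors_subset_divisors
  have hP0 : P ≠ 0 := by rintro rfl; simp at hP
  -- The exponent b = k + 2 - a is the layer of the extra element n/2^a.
  have key : ∀ b, b = k + 1 ∨ b = k → ∀ y, y = 2 ^ b * P →
      (D = valClassGeThree (2 ^ (k + 2) * P) D ∪
          (valClass (2 ^ (k + 2) * P) D 2 \ {2 ^ (k + 2) * P / 4}) ∪
          dilate 2 (valClass (2 ^ (k + 2) * P) D 2 \ {2 ^ (k + 2) * P / 4}) ∪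
          dilate 4 (valClass (2 ^ (k + 2) * P) D 2 \ {2 ^ (k + 2) * P / 4}) ∪ {y} ↔
        ∀ i Q, i ≤ k + 2 → Q ∣ P → (2 ^ i * Q ∈ D ↔
          ((((2 ^ i * Q ∈ D ∧ i < k) ∨ (i = k ∧ Q ≠ P ∧ 2 ^ k * Q ∈ D)) ∨
            (i = k + 1 ∧ Q ≠ P ∧ 2 ^ k * Q ∈ D)) ∨ (i = k + 2 ∧ Q ≠ P ∧ 2 ^ k * Q ∈ D)) ∨
            (i = b ∧ Q = P))) := by
    rintro b hb y rfl
    rw [eq_iff_of_subset_divisors hP hsub]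
    · refine forall₄_congr fun i Q hi hQ => ?_
      have d0 := two_pow_mul_mem_dilate hP hD (i := i) (s := 0) hQ
      have d1 := two_pow_mul_mem_dilate hP hD (i := i) (s := 1) hQ
      have d2 := two_pow_mul_mem_dilate hP hD (i := i) (s := 2) hQ
      rw [show ∀ X, dilate (2 ^ 0) X = X by intro X; simp [dilate]] at d0
      rw [pow_one] at d1
      rw [show 2 ^ 2 = 4 by norm_num] at d2
      simp only [Finset.mem_union, Finset.mem_singleton,
        mem_valClassGeThree_two_pow_mul hP hi hQ, d0, d1, d2,
        two_pow_mul_inj (Odd.of_dvd_nat hP hQ) hP]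
      have : i + 3 ≤ k + 2 ↔ i < k := by omega
      rw [this, add_zero]
    · refine Finset.union_subset (Finset.union_subset (Finset.union_subset (Finset.union_subset
        ((Finset.filter_subset _ _).trans hsub)
        (Finset.sdiff_subset.trans ((Finset.filter_subset _ _).trans hsub)))
        (dilate_subset_divisors hP hD one_le_two)) (dilate_subset_divisors hP hD le_rfl)) ?_
      rw [Finset.singleton_subset_iff, Nat.mem_divisors]
      exact ⟨mul_dvd_mul (pow_dvd_pow 2 (by omega)) dvd_rfl, by positivity⟩
  -- Layers below k, and layer k away from Q = P, give tautologies. At Q = P the equation says which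
  -- of n/2, n/4 is present, so the two choices of b together express the exclusive alternative.
  have key' : ∀ b, b = k + 1 ∨ b = k → ((∀ i Q, i ≤ k + 2 → Q ∣ P → (2 ^ i * Q ∈ D ↔
          ((((2 ^ i * Q ∈ D ∧ i < k) ∨ (i = k ∧ Q ≠ P ∧ 2 ^ k * Q ∈ D)) ∨
            (i = k + 1 ∧ Q ≠ P ∧ 2 ^ k * Q ∈ D)) ∨ (i = k + 2 ∧ Q ≠ P ∧ 2 ^ k * Q ∈ D)) ∨
            (i = b ∧ Q = P))) ↔
        (∀ Q, Q ∣ P → Q ≠ P → (2 ^ (k + 1) * Q ∈ D ↔ 2 ^ k * Q ∈ D) ∧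
          (2 ^ (k + 2) * Q ∈ D ↔ 2 ^ k * Q ∈ D)) ∧
        (2 ^ (k + 1) * P ∈ D ↔ b = k + 1) ∧ (2 ^ k * P ∈ D ↔ b = k)) := by
    intro b hb
    constructor
    · intro h
      refine ⟨fun Q hQ hne => ⟨?_, ?_⟩, ?_, ?_⟩
      · rw [h (k + 1) Q (by omega) hQ]
        simp [hne]
      · rw [h (k + 2) Q (by omega) hQ]
        simp [hne]
      · rw [h (k + 1) P (by omega) dvd_rfl]
        simp [eq_comm]
      · rw [h k P (by omega) dvd_rfl]
        simp [eq_comm]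
    · rintro ⟨h, h1, h2⟩ i Q hi hQ
      obtain hi | rfl | rfl | rfl : i < k ∨ i = k ∨ i = k + 1 ∨ i = k + 2 := by omega
      · have a : i ≠ k := by omega
        have a1 : i ≠ k + 1 := by omega
        have a2 : i ≠ k + 2 := by omega
        have ab : i ≠ b := by omega
        simp [a, a1, a2, ab, hi]
      · by_cases hQP : Q = P
        · subst hQP
          simp [h2, eq_comm]
        · simp [hQP]
      · by_cases hQP : Q = P
        · subst hQP
          simp [h1, eq_comm]
        · simp [hQP, (h Q hQ hQP).1]
      · by_cases hQP : Q = P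
        · subst hQP
          have : k + 2 ≠ b := by omega
          simp [hself, this]
        · simp [hQP, (h Q hQ hQP).2]
  rw [TransferStructure]
  have h1 := (key (k + 1) (Or.inl rfl) (2 ^ (k + 2) * P / 2 ^ 1)
    (by rw [pow_one, two_pow_mul_div_two])).trans (key' _ (Or.inl rfl))
  have h2 := (key k (Or.inr rfl) (2 ^ (k + 2) * P / 2 ^ 2)
    (two_pow_mul_div_four)).trans (key' _ (Or.inr rfl))
  simp only [or_and_right, exists_or, exists_eq_left]
  rw [h1, h2]
  have e : k + 1 ≠ k := by omega
  simp only [e, e.symm, iff_true, iff_false, ← and_or_left]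
  refine and_congr_right' ?_
  by_cases h1 : 2 ^ (k + 1) * P ∈ D <;> by_cases h2 : 2 ^ k * P ∈ D <;> simp [h1, h2]

end Classes

/-! ### Matrix exponentials and unitarity -/

/-- The continuous additive map M ↦ Mv is applied to the exponential series term by term. -/
theorem Matrix.exp_mulVec_of_mulVec_eq_smul {V : Type*} [Fintype V] [DecidableEq V]
    {A : Matrix V V ℂ} {v : V → ℂ} {μ : ℂ} (h : A.mulVec v = μ • v) :
    (NormedSpace.exp A).mulVec v = Complex.exp μ • v := by
  let _ : NormedRing (Matrix V V ℂ) := Matrix.linftyOpNormedRing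
  let _ : NormedAlgebra ℂ (Matrix V V ℂ) := Matrix.linftyOpNormedAlgebra
  have hpow : ∀ k : ℕ, (A ^ k).mulVec v = μ ^ k • v := by
    intro k
    induction k with
    | zero => simp
    | succ k ih => rw [pow_succ, ← Matrix.mulVec_mulVec, h, Matrix.mulVec_smul, ih, smul_smul,
        pow_succ']
  have h1 := (NormedSpace.exp_series_hasSum_exp' (𝕂 := ℂ) A).map
    (⟨⟨fun M => M.mulVec v, Matrix.zero_mulVec v⟩, fun M N => Matrix.add_mulVec M N v⟩ :
      Matrix V V ℂ →+ (V → ℂ)) (Continuous.matrix_mulVec continuous_id continuous_const)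
  have h2 := (NormedSpace.exp_series_hasSum_exp' (𝕂 := ℂ) μ).smul_const v
  rw [← Complex.exp_eq_exp_ℂ] at h2
  refine h1.unique (h2.congr_fun ?_)
  intro k
  simp [Matrix.smul_mulVec, hpow, smul_smul]

open scoped Matrix in
theorem Matrix.exp_I_smul_mem_unitary {V : Type*} [Fintype V] [DecidableEq V]
    {A : Matrix V V ℂ} (hA : A.IsHermitian) (t : ℝ) :
    NormedSpace.exp ((Complex.I * (t : ℂ)) • A) ∈ Matrix.unitaryGroup V ℂ := by
  set X := (Complex.I * (t : ℂ)) • A with hX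
  have h : Xᴴ = -X := by
    rw [hX, Matrix.conjTranspose_smul, hA.eq, ← neg_smul]
    simp
  rw [Matrix.mem_unitaryGroup_iff, Matrix.star_eq_conjTranspose, ← Matrix.exp_conjTranspose, h,
    ← Matrix.exp_add_of_commute _ _ (Commute.neg_right (Commute.refl X)), add_neg_cancel,
    NormedSpace.exp_zero]

/-- A row of a unitary matrix has Euclidean norm 1, so one entry of modulus 1 exhausts it. -/
theorem Matrix.row_eq_zero_of_norm_eq_one {V : Type*} [Fintype V] [DecidableEq V]
    {U : Matrix V V ℂ} (hU : U ∈ Matrix.unitaryGroup V ℂ) {a b : V} (h : ‖U a b‖ = 1) {x : V}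
    (hx : x ≠ b) : U a x = 0 := by
  have h1 := congrFun (congrFun (Matrix.mem_unitaryGroup_iff.1 hU) a) a
  rw [Matrix.mul_apply, Matrix.one_apply_eq] at h1
  have h2 : ∑ y, ‖U a y‖ ^ 2 = 1 := by
    have : ((∑ y, ‖U a y‖ ^ 2 : ℝ) : ℂ) = 1 := by
      rw [← h1]
      push_cast
      refine Finset.sum_congr rfl fun y _ => ?_
      rw [Matrix.star_apply, Complex.star_def, Complex.mul_conj, Complex.normSq_eq_norm_sq]
      norm_cast
    exact_mod_cast this
  rw [← Finset.add_sum_erase _ _ (Finset.mem_univ b), h, one_pow, add_eq_left] at h2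
  have := (Finset.sum_eq_zero_iff_of_nonneg (fun y _ => by positivity)).1 h2 x
    (Finset.mem_erase.2 ⟨hx, Finset.mem_univ _⟩)
  simpa using this

/-! ### Characters and integer eigenvalues -/

section Circulant

variable {n : ℕ} [NeZero n]

/-- Orthogonality on the subgroup generated by g, of order n/g: the character of j is trivial there
exactly when jg = 0. -/
theorem ZMod.sum_stdAddChar_of_dvd {g : ℕ} (hg : g ∣ n) (j : ZMod n) :
    ∑ s : ZMod n with g ∣ s.val, ZMod.stdAddChar (-(j * s)) =
      if n / g ∣ j.val then ((n / g : ℕ) : ℂ) else 0 := by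
  have hn : n ≠ 0 := NeZero.ne n
  have hg0 : g ≠ 0 := by rintro rfl; simp at hg; exact hn hg
  have hmem : ∀ s : ZMod n, g ∣ s.val ↔ ZMod.castHom hg (ZMod g) s = 0 := by
    intro s
    rw [← ZMod.natCast_eq_zero_iff, ZMod.castHom_apply, ZMod.natCast_val]
  have hjg : j * (g : ZMod n) = 0 ↔ n / g ∣ j.val := by
    obtain ⟨r, rfl⟩ := hg
    rw [Nat.mul_div_cancel_left _ (Nat.pos_of_ne_zero hg0)]
    conv_lhs => rw [← ZMod.natCast_zmod_val j, ← Nat.cast_mul, ZMod.natCast_eq_zero_iff,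
      mul_comm j.val g]
    exact Nat.mul_dvd_mul_iff_left (Nat.pos_of_ne_zero hg0)
  split_ifs with h
  · have hone : ∀ s ∈ (Finset.univ.filter fun s : ZMod n => g ∣ s.val),
        (ZMod.stdAddChar (-(j * s)) : ℂ) = 1 := by
      intro s hs
      obtain ⟨q, hq⟩ := (Finset.mem_filter.1 hs).2
      rw [← ZMod.natCast_zmod_val s, hq, Nat.cast_mul, ← mul_assoc, hjg.2 h, zero_mul, neg_zero,
        AddChar.map_zero_eq_one]
    rw [Finset.sum_congr rfl hone, Finset.sum_const, nsmul_eq_mul, mul_one]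
    congr 1
    symm
    have : (Finset.univ.filter fun s : ZMod n => g ∣ s.val) =
        (Finset.range (n / g)).image (fun q => ((g * q : ℕ) : ZMod n)) := by
      ext s
      simp only [Finset.mem_filter, Finset.mem_univ, true_and, Finset.mem_image, Finset.mem_range]
      constructor
      · rintro ⟨q, hq⟩
        refine ⟨q, ?_, by rw [← hq, ZMod.natCast_zmod_val]⟩
        have := ZMod.val_lt s
        rw [hq] at this
        rwa [Nat.lt_div_iff_mul_lt' hg]
      · rintro ⟨q, hq, rfl⟩
        rw [ZMod.val_natCast, Nat.dvd_mod_iff hg]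
        exact Dvd.intro _ rfl
    rw [this, Finset.card_image_of_injOn, Finset.card_range]
    intro a ha b hb hab
    simp only [Finset.coe_range, Set.mem_Iio, Nat.lt_div_iff_mul_lt' hg] at ha hb
    have := congrArg ZMod.val hab
    simp only [ZMod.val_natCast, Nat.mod_eq_of_lt ha, Nat.mod_eq_of_lt hb] at this
    exact Nat.eq_of_mul_eq_mul_left (Nat.pos_of_ne_zero hg0) this
  · set S := ∑ s : ZMod n with g ∣ s.val, (ZMod.stdAddChar (-(j * s)) : ℂ) with hS
    -- Translation by g preserves the subgroup and multiplies S by a value different from 1.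
    have hshift : S = ZMod.stdAddChar (-(j * (g : ZMod n))) * S := by
      rw [hS, Finset.mul_sum]
      refine Finset.sum_bij' (fun s _ => s - g) (fun s _ => s + g) ?_ ?_ ?_ ?_ ?_
      · intro s hs
        rw [Finset.mem_filter, hmem] at hs ⊢
        simpa only [Finset.mem_univ, true_and, map_sub, map_natCast, ZMod.natCast_self, sub_zero] using hs
      · intro s hs
        rw [Finset.mem_filter, hmem] at hs ⊢
        simpa only [Finset.mem_univ, true_and, map_add, map_natCast, ZMod.natCast_self, add_zero] using hs
      · simp
      · simp
      · intro s _
        rw [← AddChar.map_add_eq_mul]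
        congr 1
        ring
    have hne : (ZMod.stdAddChar (-(j * (g : ZMod n))) : ℂ) ≠ 1 := by
      intro h1
      rw [← AddChar.map_zero_eq_one (ZMod.stdAddChar (N := n)),
        ZMod.injective_stdAddChar.eq_iff, neg_eq_zero, hjg] at h1
      exact h h1
    have : (1 - ZMod.stdAddChar (-(j * (g : ZMod n)))) * S = 0 := by
      rw [sub_mul, one_mul, ← hshift, sub_self]
    exact (mul_eq_zero.1 this).resolve_left (sub_ne_zero.2 hne.symm)

/-- The eigenvalues of the integral circulant graph are integers, given by `dualDivisorSum`. -/
theorem sum_indicator_mul_stdAddChar {D : Finset ℕ} {G : ℕ → ℤ}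
    (hG : ∀ d, d ∣ n → (if d ∈ D then 1 else 0) = ∑ g ∈ d.divisors, G g) (j : ZMod n) :
    ∑ s : ZMod n, (if Nat.gcd s.val n ∈ D then (1 : ℂ) else 0) * ZMod.stdAddChar (-(j * s)) =
      (dualDivisorSum n G (Nat.gcd j.val n) : ℂ) := by
  have hn : n ≠ 0 := NeZero.ne n
  have h1 : ∀ s : ZMod n, (if Nat.gcd s.val n ∈ D then (1 : ℂ) else 0) =
      ∑ g ∈ n.divisors, if g ∣ s.val then (G g : ℂ) else 0 := by
    intro s
    have := congrArg (Int.cast : ℤ → ℂ) (hG _ (Nat.gcd_dvd_right s.val n))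
    push_cast at this
    rw [this, ← Finset.sum_filter]
    refine Finset.sum_congr ?_ fun _ _ => rfl
    ext g
    simp [hn, Nat.dvd_gcd_iff, and_comm]
  simp only [h1, Finset.sum_mul]
  rw [Finset.sum_comm]
  have h2 : ∀ g ∈ n.divisors, ∑ s : ZMod n,
      (if g ∣ s.val then (G g : ℂ) else 0) * ZMod.stdAddChar (-(j * s)) =
      if n / g ∣ j.val then ((n / g : ℕ) : ℂ) * G g else 0 := by
    intro g hg
    have := ZMod.sum_stdAddChar_of_dvd (Nat.dvd_of_mem_divisors hg) j
    simp only [ite_mul, zero_mul]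
    rw [← Finset.sum_filter, ← Finset.mul_sum, this]
    split_ifs
    · ring
    · simp
  -- The reindexing g ↦ n/g turns the condition n/g ∣ j into g ∣ j.
  rw [Finset.sum_congr rfl h2, dualDivisorSum, ← Nat.sum_div_divisors, ← Finset.sum_filter]
  push_cast
  have h3 : ∀ g ∈ n.divisors, n / (n / g) = g := fun g hg =>
    Nat.div_div_self (Nat.dvd_of_mem_divisors hg) hn
  refine Finset.sum_congr ?_ fun g hg => ?_
  · ext g
    simp only [Finset.mem_filter, Nat.mem_divisors, Nat.dvd_gcd_iff]
    constructor
    · rintro ⟨⟨a, _⟩, b⟩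
      rw [Nat.div_div_self a hn] at b
      exact ⟨⟨b, a⟩, by simp [hn]⟩
    · rintro ⟨⟨a, b⟩, _⟩
      rw [Nat.div_div_self b hn]
      exact ⟨⟨b, hn⟩, a⟩
  · rw [h3 g (Nat.mem_divisors.2 ⟨(Nat.dvd_of_mem_divisors hg).trans (Nat.gcd_dvd_right _ _), hn⟩)]

open Classical in
theorem adjMatrix_integralCirculant_mulVec {D : Finset ℕ} (hD : D ⊆ n.properDivisors)
    {G : ℕ → ℤ} (hG : ∀ d, d ∣ n → (if d ∈ D then 1 else 0) = ∑ g ∈ d.divisors, G g)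
    (j : ZMod n) :
    ((integralCirculant n D).adjMatrix ℂ).mulVec (fun x => ZMod.stdAddChar (j * x)) =
      (dualDivisorSum n G (Nat.gcd j.val n) : ℂ) • fun x => ZMod.stdAddChar (j * x) := by
  funext a
  rw [Pi.smul_apply, smul_eq_mul, ← sum_indicator_mul_stdAddChar hG, Matrix.mulVec, dotProduct,
    Finset.sum_mul, ← Equiv.sum_comp (Equiv.subLeft a)]
  refine Finset.sum_congr rfl fun s _ => ?_
  rw [SimpleGraph.adjMatrix_apply, integralCirculant_adj hD, mul_assoc, ← AddChar.map_add_eq_mul]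
  simp only [Equiv.subLeft_apply, sub_sub_cancel]
  congr 2
  ring

end Circulant

/-! ### Phases of integer eigenvalues -/

theorem hasPST_iff {V : Type*} [Fintype V] [inst : DecidableEq V] (G : SimpleGraph V)
    [inst' : DecidableRel G.Adj] :
    HasPST G ↔ ∃ a b : V, a ≠ b ∧ ∃ t : ℝ, 0 < t ∧
      ‖(NormedSpace.exp ((Complex.I * (t : ℂ)) • G.adjMatrix ℂ) : Matrix V V ℂ) a b‖ = 1 := by
  obtain rfl : inst = fun _ _ => Classical.propDecidable _ := Subsingleton.elim _ _
  obtain rfl : inst' = fun _ _ => Classical.propDecidable _ := Subsingleton.elim _ _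
  rfl

theorem exists_phase_iff_parityCongruence {n : ℕ} (hn : Even n) (L : ℕ → ℤ) :
    (∃ t : ℝ, 0 < t ∧ ∃ u : ℂ, ‖u‖ = 1 ∧ ∀ c, c ∣ n →
      Complex.exp (Complex.I * t * (L c : ℂ)) = u * (-1) ^ c) ↔ ParityCongruence n L := by
  have hpow : ∀ c : ℕ, Complex.exp (Real.pi * Complex.I * c) = (-1) ^ c := by
    intro c
    rw [mul_comm, Complex.exp_nat_mul, Complex.exp_pi_mul_I]
  have hpi : (Real.pi : ℂ) ≠ 0 := Complex.ofReal_ne_zero.2 Real.pi_ne_zero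
  constructor
  · rintro ⟨t, ht, u, hu, h⟩
    have hu' : Complex.exp (Complex.I * t * (L n : ℂ)) = u := by
      rw [h n dvd_rfl, hn.neg_one_pow, mul_one]
    have key : ∀ c, c ∣ n → ∃ z : ℤ, t * (L c - L n : ℤ) = Real.pi * ((c + 2 * z : ℤ) : ℝ) := by
      intro c hc
      have h1 := h c hc
      rw [← hu', ← hpow, ← Complex.exp_add, Complex.exp_eq_exp_iff_exists_int] at h1
      obtain ⟨z, hz⟩ := h1
      refine ⟨z, ?_⟩
      have : (Complex.I * ((t * (L c - L n : ℤ) : ℝ) : ℂ)) =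
          Complex.I * ((Real.pi * ((c + 2 * z : ℤ) : ℝ) : ℝ) : ℂ) := by
        push_cast
        linear_combination hz
      exact_mod_cast mul_left_cancel₀ Complex.I_ne_zero this
    obtain ⟨z₁, h₁⟩ := key 1 (one_dvd n)
    have hodd1 : ((1 : ℕ) : ℤ) + 2 * z₁ ≠ 0 := by push_cast; omega
    have hne : L 1 - L n ≠ 0 := by
      intro h0
      rw [h0, Int.cast_zero, mul_zero, eq_comm, mul_eq_zero] at h₁
      exact hodd1 (by exact_mod_cast h₁.resolve_left Real.pi_ne_zero)
    -- m is the 2-adic valuation of L(1) - L(n), nonzero because t(L(1) - L(n)) is an odd multiple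
    -- of π.
    obtain ⟨m, w, hw, hmw⟩ : ∃ (m : ℕ) (w : ℤ), ¬ (2 : ℤ) ∣ w ∧ L 1 - L n = 2 ^ m * w := by
      have hf : FiniteMultiplicity (2 : ℤ) (L 1 - L n) := by
        rw [Int.finiteMultiplicity_iff]
        exact ⟨by norm_num, hne⟩
      obtain ⟨w, hw1, hw2⟩ := hf.exists_eq_pow_mul_and_not_dvd
      exact ⟨_, w, hw2, hw1⟩
    refine ⟨m, fun c hc => ?_⟩
    obtain ⟨z, hz⟩ := key c hc
    -- Cross-multiplying with the case c = 1 eliminates t; the odd factor 1 + 2z₁ is then cancelled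
    -- modulo 2^(m+1).
    have hcross : (L c - L n) * ((1 : ℕ) + 2 * z₁) = (L 1 - L n) * (c + 2 * z) := by
      have : t * Real.pi * (((L c - L n) * ((1 : ℕ) + 2 * z₁) : ℤ) : ℝ) =
          t * Real.pi * (((L 1 - L n) * (c + 2 * z) : ℤ) : ℝ) := by
        rw [Int.cast_mul, Int.cast_mul]
        linear_combination (Real.pi * ((((1 : ℕ) : ℤ) + 2 * z₁ : ℤ) : ℝ)) * hz -
          (Real.pi * (((c : ℤ) + 2 * z : ℤ) : ℝ)) * h₁
      exact_mod_cast mul_left_cancel₀ (mul_ne_zero ht.ne' Real.pi_ne_zero) this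
    have hcop : IsCoprime ((2 : ℤ) ^ (m + 1)) ((1 : ℕ) + 2 * z₁) := by
      refine IsCoprime.pow_left ⟨-z₁, 1, ?_⟩
      push_cast; ring
    refine hcop.dvd_of_dvd_mul_right ?_
    rw [sub_mul, hcross, hmw, pow_succ]
    split_ifs with hodd
    · rw [mul_assoc, ← mul_sub]
      refine mul_dvd_mul_left _ ?_
      obtain ⟨e, he⟩ := hodd
      obtain ⟨w', rfl⟩ : ∃ w', w = 2 * w' + 1 := ⟨w / 2, by omega⟩
      refine ⟨w' * (c + 2 * z) + e + z - z₁, ?_⟩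
      rw [he]
      push_cast
      ring
    · rw [zero_mul, sub_zero, mul_assoc]
      refine mul_dvd_mul_left _ (Dvd.dvd.mul_left ?_ _)
      have := (Nat.not_odd_iff_even.1 hodd).two_dvd
      omega
  · rintro ⟨m, hm⟩
    -- At time π/2^m, a difference 2^m modulo 2^(m+1) contributes the phase -1.
    refine ⟨Real.pi / 2 ^ m, by positivity,
      Complex.exp (Complex.I * ((Real.pi / 2 ^ m : ℝ) : ℂ) * (L n : ℂ)), ?_, fun c hc => ?_⟩
    · rw [mul_assoc, mul_comm]
      exact_mod_cast Complex.norm_exp_ofReal_mul_I (Real.pi / 2 ^ m * (L n : ℝ))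
    · obtain ⟨z, hz⟩ := hm c hc
      have hpar : (-1 : ℂ) ^ c = (-1) ^ (if Odd c then 1 else 0) := by
        split_ifs with ho
        · rw [ho.neg_one_pow, pow_one]
        · rw [(Nat.not_odd_iff_even.1 ho).neg_one_pow, pow_zero]
      have hL : L c = L n + 2 ^ m * ((if Odd c then 1 else 0 : ℕ) + 2 * z) := by
        split_ifs at hz ⊢ <;> rw [pow_succ] at hz <;> push_cast <;> linear_combination hz
      rw [hpar, ← hpow, ← Complex.exp_add, Complex.exp_eq_exp_iff_exists_int]
      refine ⟨z, ?_⟩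
      rw [hL]
      have h2 : (2 : ℂ) ^ m ≠ 0 := pow_ne_zero m two_ne_zero
      push_cast
      field_simp
      ring

/-! ### Perfect state transfer in terms of the divisor set -/

section PerfectStateTransfer

variable {n : ℕ} [NeZero n]

theorem ZMod.stdAddChar_mul_eq_pow (j k : ZMod n) :
    (ZMod.stdAddChar (j * k) : ℂ) = ZMod.stdAddChar k ^ j.val := by
  rw [← AddChar.map_nsmul_eq_pow, nsmul_eq_mul, ZMod.natCast_zmod_val]

theorem ZMod.gcd_neg_val (j : ZMod n) : Nat.gcd (-j).val n = Nat.gcd j.val n := by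
  rw [ZMod.neg_val]
  split_ifs with h
  · simp [h]
  · rw [Nat.gcd_comm, Nat.gcd_comm j.val, Nat.gcd_self_sub_right (ZMod.val_lt j).le]

theorem Nat.neg_one_pow_gcd {n : ℕ} (hn : Even n) (j : ℕ) :
    (-1 : ℂ) ^ Nat.gcd j n = (-1) ^ j := by
  have : Even (Nat.gcd j n) ↔ Even j := by
    rw [even_iff_two_dvd, even_iff_two_dvd, Nat.dvd_gcd_iff]
    exact and_iff_left hn.two_dvd
  rcases Nat.even_or_odd j with h | h
  · rw [h.neg_one_pow, (this.2 h).neg_one_pow]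
  · rw [h.neg_one_pow, Odd.neg_one_pow]
    rwa [← Nat.not_even_iff_odd, this, Nat.not_even_iff_odd]

/-- Perfect state transfer in terms of the phases of the integral eigenvalues. -/
theorem hasPST_integralCirculant_iff_exp {D : Finset ℕ} (hD : D ⊆ n.properDivisors)
    {G : ℕ → ℤ} (hG : ∀ d, d ∣ n → (if d ∈ D then 1 else 0) = ∑ g ∈ d.divisors, G g) :
    HasPST (integralCirculant n D) ↔ Even n ∧ ∃ t : ℝ, 0 < t ∧ ∃ u : ℂ, ‖u‖ = 1 ∧ ∀ c, c ∣ n →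
      Complex.exp (Complex.I * t * (dualDivisorSum n G c : ℂ)) = u * (-1) ^ c := by
  classical
  rw [hasPST_iff]
  have hn : n ≠ 0 := NeZero.ne n
  have hexp : ∀ (t : ℝ) (j : ZMod n),
      (NormedSpace.exp ((Complex.I * (t : ℂ)) • (integralCirculant n D).adjMatrix ℂ)).mulVec
        (fun x => ZMod.stdAddChar (j * x)) =
      Complex.exp (Complex.I * t * (dualDivisorSum n G (Nat.gcd j.val n) : ℂ)) •
        fun x => ZMod.stdAddChar (j * x) := by
    intro t j
    apply Matrix.exp_mulVec_of_mulVec_eq_smul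
    rw [Matrix.smul_mulVec, adjMatrix_integralCirculant_mulVec hD hG, smul_smul]
  constructor
  · rintro ⟨a, b, hab, t, ht, h⟩
    have hU : NormedSpace.exp ((Complex.I * (t : ℂ)) • (integralCirculant n D).adjMatrix ℂ) ∈
        Matrix.unitaryGroup (ZMod n) ℂ :=
      Matrix.exp_I_smul_mem_unitary (by
        rw [Matrix.IsHermitian, Matrix.conjTranspose, SimpleGraph.transpose_adjMatrix]
        ext x y
        simp [SimpleGraph.adjMatrix_apply, apply_ite]) t
    set U := NormedSpace.exp ((Complex.I * (t : ℂ)) • (integralCirculant n D).adjMatrix ℂ)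
      with hUdef
    -- Row a of U has its only nonzero entry at b, so each eigenvector equation evaluated at a
    -- reduces to one term.
    have hphase : ∀ j : ZMod n,
        Complex.exp (Complex.I * t * (dualDivisorSum n G (Nat.gcd j.val n) : ℂ)) =
          U a b * ZMod.stdAddChar (j * (b - a)) := by
      intro j
      have h1 : U.mulVec (fun x => ZMod.stdAddChar (j * x)) a = _ := congrFun (hexp t j) a
      rw [Matrix.mulVec, dotProduct, Finset.sum_eq_single b
        (fun x _ hx => by rw [Matrix.row_eq_zero_of_norm_eq_one hU h hx, zero_mul])
        (fun h => absurd (Finset.mem_univ _) h), Pi.smul_apply, smul_eq_mul] at h1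
      have h2 : (ZMod.stdAddChar (-(j * a)) : ℂ) * ZMod.stdAddChar (j * a) = 1 := by
        rw [← AddChar.map_add_eq_mul, neg_add_cancel, AddChar.map_zero_eq_one]
      rw [mul_sub, sub_eq_add_neg, AddChar.map_add_eq_mul, ← mul_assoc, h1]
      linear_combination (-Complex.exp (Complex.I * t *
        (dualDivisorSum n G (Nat.gcd j.val n) : ℂ))) * h2
    have hU0 : U a b ≠ 0 := by
      rw [← norm_ne_zero_iff, h]; exact one_ne_zero
    -- The frequencies 1 and -1 share an eigenvalue, so the character takes equal values at b - a
    -- and a - b.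
    have hsq : (ZMod.stdAddChar (b - a) : ℂ) ^ 2 = 1 := by
      have h1 := hphase 1
      have h2 := hphase (-1)
      rw [ZMod.gcd_neg_val, h1] at h2
      have h3 := mul_left_cancel₀ hU0 h2
      rw [sq, ← AddChar.map_zero_eq_one (ZMod.stdAddChar (N := n))]
      nth_rw 1 [← one_mul (b - a)]
      rw [h3, ← AddChar.map_add_eq_mul]
      congr 1
      ring
    have hneg : (ZMod.stdAddChar (b - a) : ℂ) = -1 := by
      refine (sq_eq_one_iff.1 hsq).resolve_left ?_
      intro h1
      rw [← AddChar.map_zero_eq_one (ZMod.stdAddChar (N := n)),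
        ZMod.injective_stdAddChar.eq_iff, sub_eq_zero] at h1
      exact hab h1.symm
    have heven : Even n := by
      have h1 : (ZMod.stdAddChar (b - a) : ℂ) ^ n = 1 := by
        rw [← AddChar.map_nsmul_eq_pow, nsmul_eq_mul, CharP.cast_eq_zero, zero_mul,
          AddChar.map_zero_eq_one]
      rw [hneg] at h1
      exact (neg_one_pow_eq_one_iff_even (by norm_num)).1 h1
    refine ⟨heven, t, ht, U a b, h, fun c hc => ?_⟩
    have h1 := hphase (c : ZMod n)
    have h2 : Nat.gcd (c : ZMod n).val n = c := by
      rw [ZMod.val_natCast, ← Nat.gcd_rec, Nat.gcd_comm, Nat.gcd_eq_left hc]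
    rw [h2, ZMod.stdAddChar_mul_eq_pow, hneg, ← Nat.neg_one_pow_gcd heven, h2] at h1
    exact h1
  · rintro ⟨heven, t, ht, u, hu, h⟩
    obtain ⟨N, hN⟩ := heven
    have hN0 : 0 < N := by omega
    have hval : ((N : ℕ) : ZMod n).val = N := ZMod.val_natCast_of_lt (by omega)
    have hNne : ((N : ℕ) : ZMod n) ≠ 0 := by
      intro h0
      rw [h0, ZMod.val_zero] at hval
      omega
    have hchar : (ZMod.stdAddChar ((N : ℕ) : ZMod n) : ℂ) = -1 := by
      refine (sq_eq_one_iff.1 ?_).resolve_left ?_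
      · rw [sq, ← AddChar.map_add_eq_mul, ← Nat.cast_add, ← hN, CharP.cast_eq_zero,
          AddChar.map_zero_eq_one]
      · rw [← AddChar.map_zero_eq_one (ZMod.stdAddChar (N := n)),
          ZMod.injective_stdAddChar.eq_iff]
        exact hNne
    -- Transfer goes from 0 to the antipode n/2, where the character of j equals (-1)^j.
    refine ⟨0, N, hNne.symm, t, ht, ?_⟩
    set U := NormedSpace.exp ((Complex.I * (t : ℂ)) • (integralCirculant n D).adjMatrix ℂ)
      with hUdef
    have hrow : ∀ j : ZMod n, ∑ x, U 0 x * ZMod.stdAddChar (j * x) =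
        u * ZMod.stdAddChar (j * (N : ZMod n)) := by
      intro j
      have h1 := congrFun (hexp t j) 0
      rw [Matrix.mulVec, dotProduct, Pi.smul_apply, smul_eq_mul, h _ (Nat.gcd_dvd_right _ _),
        Nat.neg_one_pow_gcd ⟨N, hN⟩, mul_zero, AddChar.map_zero_eq_one, mul_one] at h1
      rw [h1, ZMod.stdAddChar_mul_eq_pow j (N : ZMod n), hchar]
    -- Fourier inversion recovers the entry of U from the transform of row 0.
    have hsum : ∑ j : ZMod n, (∑ x, U 0 x * ZMod.stdAddChar (j * x)) *
        ZMod.stdAddChar (-(j * (N : ZMod n))) = n * U 0 N := by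
      simp only [Finset.sum_mul]
      rw [Finset.sum_comm, Finset.sum_eq_single (N : ZMod n)]
      · have : ∀ j : ZMod n, U 0 N * ZMod.stdAddChar (j * (N : ZMod n)) *
            ZMod.stdAddChar (-(j * (N : ZMod n))) = U 0 N := by
          intro j
          rw [mul_assoc, ← AddChar.map_add_eq_mul, add_neg_cancel, AddChar.map_zero_eq_one,
            mul_one]
        simp [this]
      · intro x _ hx
        have : ∀ j : ZMod n, U 0 x * ZMod.stdAddChar (j * x) *
            ZMod.stdAddChar (-(j * (N : ZMod n))) =
            U 0 x * ZMod.stdAddChar (j * (x - (N : ZMod n))) := by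
          intro j
          rw [mul_assoc, ← AddChar.map_add_eq_mul, mul_sub, sub_eq_add_neg]
        simp only [this]
        rw [← Finset.mul_sum, AddChar.sum_mulShift _ (ZMod.isPrimitive_stdAddChar n),
          if_neg (sub_ne_zero.2 hx)]
        simp
      · exact fun h => absurd (Finset.mem_univ _) h
    have hsum' : ∑ j : ZMod n, (∑ x, U 0 x * ZMod.stdAddChar (j * x)) *
        ZMod.stdAddChar (-(j * (N : ZMod n))) = n * u := by
      have : ∀ j : ZMod n, u * ZMod.stdAddChar (j * (N : ZMod n)) *
            ZMod.stdAddChar (-(j * (N : ZMod n))) = u := by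
        intro j
        rw [mul_assoc, ← AddChar.map_add_eq_mul, add_neg_cancel, AddChar.map_zero_eq_one,
          mul_one]
      simp [hrow, this]
    have hU : U 0 N = u := mul_left_cancel₀ (Nat.cast_ne_zero.2 hn) (hsum.symm.trans hsum')
    rw [hU, hu]

theorem hasPST_integralCirculant_iff {D : Finset ℕ} (hD : D ⊆ n.properDivisors)
    {G : ℕ → ℤ} (hG : ∀ d, d ∣ n → (if d ∈ D then 1 else 0) = ∑ g ∈ d.divisors, G g) :
    HasPST (integralCirculant n D) ↔ Even n ∧ ParityCongruence n (dualDivisorSum n G) := by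
  rw [hasPST_integralCirculant_iff_exp hD hG]
  exact and_congr_right fun h => exists_phase_iff_parityCongruence h _

/-- A connected integral circulant graph whose divisors are all multiples of `g` has `g = 1`. -/
theorem eq_one_of_integralCirculant_connected {D : Finset ℕ} (hD : D ⊆ n.properDivisors)
    (hconn : (integralCirculant n D).Connected) {g : ℕ} (hg : g ∣ n) (h : ∀ d ∈ D, g ∣ d) :
    g = 1 := by
  have key : ∀ a b : ZMod n, (integralCirculant n D).Reachable a b →
      ZMod.castHom hg (ZMod g) a = ZMod.castHom hg (ZMod g) b := by
    intro a b hab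
    rw [SimpleGraph.reachable_iff_reflTransGen] at hab
    induction hab with
    | refl => rfl
    | tail _ hbc ih =>
      rw [ih, ← sub_eq_zero, ← map_sub, ZMod.castHom_apply, ← ZMod.natCast_val,
        ZMod.natCast_eq_zero_iff]
      exact (h _ ((integralCirculant_adj hD _ _).1 hbc)).trans (Nat.gcd_dvd_left _ _)
  have := key 1 0 (hconn.preconnected 1 0)
  rw [map_one, map_zero, ← Nat.cast_one, ZMod.natCast_eq_zero_iff] at this
  exact Nat.dvd_one.1 this

theorem exists_moebius_inverse (F : ℕ → ℤ) :
    ∃ G : ℕ → ℤ, ∀ d, d ≠ 0 → F d = ∑ g ∈ d.divisors, G g := by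
  refine ⟨fun n => ∑ x ∈ n.divisorsAntidiagonal, (ArithmeticFunction.moebius x.1 : ℤ) * F x.2,
    fun d hd => ?_⟩
  have := (ArithmeticFunction.sum_eq_iff_sum_mul_moebius_eq (R := ℤ) (g := F)
    (f := fun n => ∑ x ∈ n.divisorsAntidiagonal, (ArithmeticFunction.moebius x.1 : ℤ) * F x.2)).2
    (fun _ _ => by simp)
  exact (this d (Nat.pos_of_ne_zero hd)).symm

theorem hasPST_iff_transferStructure {k P : ℕ} (hP : Odd P) [NeZero (2 ^ (k + 2) * P)]
    {D : Finset ℕ} (hD : D ⊆ (2 ^ (k + 2) * P).properDivisors) :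
    HasPST (integralCirculant (2 ^ (k + 2) * P) D) ↔ TransferStructure k P D := by
  obtain ⟨G, hG⟩ := exists_moebius_inverse (fun d => if d ∈ D then 1 else 0)
  have hG' : ∀ d, d ∣ 2 ^ (k + 2) * P → (if d ∈ D then 1 else 0) = ∑ g ∈ d.divisors, G g :=
    fun d hd => hG d (ne_zero_of_dvd_ne_zero (NeZero.ne _) hd)
  have hF : ∀ d, (if d ∈ D then (1 : ℤ) else 0) = 0 ∨ (if d ∈ D then (1 : ℤ) else 0) = 1 :=
    fun d => by split_ifs <;> simp
  have hite : ∀ a b : ℕ, ((if a ∈ D then (1 : ℤ) else 0) = if b ∈ D then 1 else 0) ↔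
      (a ∈ D ↔ b ∈ D) := fun a b => by split_ifs <;> simp [*]
  have heven : Even (2 ^ (k + 2) * P) := by
    rw [pow_succ', mul_assoc]; exact even_two_mul _
  rw [hasPST_integralCirculant_iff hD hG', and_iff_right heven, TransferStructure]
  constructor
  · intro h
    have := h.structure_of_four_dvd hP hF hG'
    simpa only [hite, ne_eq] using this
  · rintro ⟨h1, h2⟩
    refine parityCongruence_of_structure hP hF hG' ?_ ?_
    · simpa only [hite] using h1
    · simpa only [hite, ne_eq] using h2

/-- If n = 2P with P odd, the congruences put `D` inside the multiples of P; connectedness then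
gives P = 1, the excluded case n = 2. -/
theorem four_dvd_of_hasPST (hn : n ≠ 2) {D : Finset ℕ} (hD : D ⊆ n.properDivisors)
    (hconn : (integralCirculant n D).Connected) (h : HasPST (integralCirculant n D)) : 4 ∣ n := by
  obtain ⟨G, hG⟩ := exists_moebius_inverse (fun d => if d ∈ D then 1 else 0)
  have hG' : ∀ d, d ∣ n → (if d ∈ D then 1 else 0) = ∑ g ∈ d.divisors, G g :=
    fun d hd => hG d (ne_zero_of_dvd_ne_zero (NeZero.ne _) hd)
  rw [hasPST_integralCirculant_iff hD hG'] at h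
  obtain ⟨heven, h⟩ := h
  obtain ⟨P, rfl⟩ := heven.two_dvd
  by_contra h4
  have hP : Odd P := by
    rw [← Nat.not_even_iff_odd]
    rintro ⟨r, rfl⟩
    exact h4 ⟨r, by ring⟩
  have hs := h.structure_of_two_mul_odd hP (fun d => by split_ifs <;> simp) hG'
  have hP1 : P = 1 := by
    refine eq_one_of_integralCirculant_connected hD hconn (Dvd.intro_left _ rfl) fun d hd => ?_
    obtain ⟨hdn, hlt⟩ := Nat.mem_properDivisors.1 (hD hd)
    obtain ⟨i, Q, hi, hQ, rfl⟩ := exists_eq_two_pow_mul_of_dvd (e := 1) hP (by simpa using hdn)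
    by_cases hQP : Q = P
    · rw [hQP]; exact Dvd.intro_left _ rfl
    · have := hs Q hQ hQP
      interval_cases i <;> simp_all
  exact hn (by rw [hP1, mul_one])

end PerfectStateTransfer

theorem mainTheorem1 (n : ℕ) [NeZero n] (hn : n ≠ 2) (D : Finset ℕ) (hD : D ⊆ n.properDivisors)
    (hconn : (integralCirculant n D).Connected) :
    (HasPST (integralCirculant n D) ↔
      4 ∣ n ∧
      valClass n D 1 \ {n / 2} = dilate 2 (valClass n D 2 \ {n / 4}) ∧
      valClass n D 0 = dilate 4 (valClass n D 2 \ {n / 4}) ∧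
      ((n / 2 ∈ D ∧ n / 4 ∉ D) ∨ (n / 4 ∈ D ∧ n / 2 ∉ D))) ∧
    (HasPST (integralCirculant n D) ↔
      4 ∣ n ∧ ∃ a : ℕ, (a = 1 ∨ a = 2) ∧
        D = valClassGeThree n D ∪ (valClass n D 2 \ {n / 4}) ∪
          dilate 2 (valClass n D 2 \ {n / 4}) ∪ dilate 4 (valClass n D 2 \ {n / 4}) ∪
          {n / 2 ^ a}) := by
  by_cases h4 : 4 ∣ n
  · obtain ⟨e, P, hP, rfl⟩ := Nat.exists_eq_two_pow_mul_odd (NeZero.ne n)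
    have he : 2 ≤ e := by
      have : 2 ^ 2 ∣ 2 ^ e := (Nat.Coprime.pow_left 2
        (Nat.coprime_two_left.2 hP)).dvd_of_dvd_mul_right h4
      exact (Nat.pow_dvd_pow_iff_le_right (by norm_num)).1 this
    obtain ⟨k, rfl⟩ := Nat.exists_eq_add_of_le' he
    rw [hasPST_iff_transferStructure hP hD, and_iff_right h4, and_iff_right h4]
    exact ⟨transferStructure_iff_valClass hP hD, transferStructure_iff_eq_union hP hD⟩
  · have hno : ¬ HasPST (integralCirculant n D) := fun h => h4 (four_dvd_of_hasPST hn hD hconn h)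
    exact ⟨iff_of_false hno fun h => h4 h.1, iff_of_false hno fun h => h4 h.1⟩
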